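/- Let $q\ge 1$ be an integer and let $G=(V,E)$ be a finite non-empty undirected $(q+1)$-regular graph, possibly with multiple edges and loops. Each edge (loops included) corresponds to two mutually inverse, distinct directed edges $e,\bar e$; let $\vec E$ be the set of directed edges, let $o(e)$ and $t(e)$ be the origin and terminus of $e\in\vec E$, and let the degree of a vertex $v$ be the number of $e\in\vec E$ with $o(e)=v$. For $n\ge 1$ choose $\sigma$ uniformly at random from all maps $\sigma:\vec E\to S_n$ with $\sigma(\bar e)=\sigma(e)^{-1}$ for all $e\in\vec E$, and let $G_n$ be the corresponding random $n$-lift of $G$: its vertex set is $V\times\{1,\dots,n\}$ and its directed edges are the pairs $(e,i)\in\vec E\times\{1,\dots,n\}$, where $(e,i)$ goes from $(o(e),i)$ to $(t(e),\sigma(e)(i))$ and has inverse $(\bar e,\sigma(e)(i))$. Let $$\mu_n=\frac1{n|V|}\sum_{k=1}^{n|V|}\delta_{q^{-1/2}\lambda_k}$$ be the normalized spectral measure of $G_n$, where $\lambda_1,\dots,\lambda_{n|V|}$ are the eigenvalues, with multiplicity, of the adjacency matrix of $G_n$ (whose entries count the directed edges between vertices). Let $\mu_q$ be the Kesten–McKay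 distribution, i.e. the normalized spectral measure of the $(q+1)$-regular tree $\mathbb T_q$: the unique probability measure of bounded support on $\mathbb R$ such that $\int P\,d\mu_q=\langle \mathbf 1_x,P(q^{-1/2}A(\mathbb T_q))\mathbf 1_x\rangle$ for every real polynomial $P$, where $x$ is a vertex of $\mathbb T_q$ and $A(\mathbb T_q)$ is its adjacency operator. Then $\mu_n$ converges weakly to $\mu_q$ in probability: for every metric $d$ on the set of probability measures on $\mathbb R$ whose convergent sequences are the weakly convergent ones (with the same limits), and for every $\varepsilon>0$, $$\mathbf P\bigl(d(\mu_n,\mu_q)>\varepsilon\bigr)\to 0\qquad\text{as } n\to\infty .$$ -/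

import Mathlib

open MeasureTheory Filter Topology

noncomputable section

/-! ## Graphs -/

/-- An undirected graph with vertex set `V`, possibly with multiple edges and loops, presented by
its set `E` of directed edges: each undirected edge (loops included) corresponds to two distinct
directed edges `e` and `inv e`, which are inverse to each other. -/
structure SerreGraph (V E : Type*) where
  /-- the origin of a directed edge -/
  o : E → V
  /-- the terminus of a directed edge -/
  t : E → V
  /-- the inverse of a directed edge -/
  inv : E → E
  inv_inv : ∀ e, inv (inv e) = e
  inv_ne : ∀ e, inv e ≠ e
  o_inv : ∀ e, o (inv e) = t e

namespace SerreGraph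

variable {V E : Type*} (G : SerreGraph V E)

theorem t_inv (e : E) : G.t (G.inv e) = G.o e := by
  rw [← G.o_inv, G.inv_inv]

/-- `G` is `d`-regular: every vertex is the origin of exactly `d` directed edges
(so a loop contributes `2` to the degree of its vertex). Used for `d ≥ 1` only. -/
def IsRegular (d : ℕ) : Prop := ∀ v, Nat.card {e : E // G.o e = v} = d

/-- The adjacency matrix: the entry at `(u, v)` is the number of directed edges from `u` to `v`. -/
def adjMatrix : Matrix V V ℝ :=
  Matrix.of fun u v => (Nat.card {e : E // G.o e = u ∧ G.t e = v} : ℝ)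

theorem adjMatrix_isHermitian : G.adjMatrix.IsHermitian := by
  ext u v
  simp only [adjMatrix, Matrix.conjTranspose_apply, Matrix.of_apply, star_trivial, Nat.cast_inj]
  refine Nat.card_congr ⟨fun e => ⟨G.inv e.1, ?_⟩, fun e => ⟨G.inv e.1, ?_⟩, ?_, ?_⟩
  · rw [G.o_inv, G.t_inv]; exact e.2.symm
  · rw [G.o_inv, G.t_inv]; exact e.2.symm
  · intro e; simp [G.inv_inv]
  · intro e; simp [G.inv_inv]

/-- The normalized spectral measure `|V|⁻¹ ∑ₖ δ_{q^{-1/2} λₖ}` of a finite graph, where the `λₖ` are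
the eigenvalues of the adjacency matrix with multiplicity. -/
def normalizedSpectralMeasure [Fintype V] [DecidableEq V] [Nonempty V] (q : ℕ) :
    ProbabilityMeasure ℝ :=
  ⟨(Fintype.card V : ENNReal)⁻¹ •
      ∑ k : V, Measure.dirac ((√(q : ℝ))⁻¹ * G.adjMatrix_isHermitian.eigenvalues k), by
    constructor
    simp only [Measure.smul_apply, Measure.coe_finsetSum, Finset.sum_apply, measure_univ,
      Finset.sum_const, Finset.card_univ, smul_eq_mul, nsmul_eq_mul, mul_one]
    exact ENNReal.inv_mul_cancel (by simp) (by simp)⟩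

/-- The adjacency operator `(A f)(v) = ∑_{e : o(e) = v} f(t(e))` of a graph in which every vertex
is the origin of finitely many directed edges, on functions on the vertices. -/
def adjOperator [∀ v, Fintype {e : E // G.o e = v}] : Module.End ℝ (V → ℝ) where
  toFun f v := ∑ e : {e : E // G.o e = v}, f (G.t e.1)
  map_add' f g := by ext v; simp [Finset.sum_add_distrib]
  map_smul' c f := by ext v; simp [Finset.mul_sum]

/-- `μ` is the normalized spectral measure at the vertex `x` of a locally finite graph: it has
bounded support and `∫ P dμ = ⟨1ₓ, P(q^{-1/2} A) 1ₓ⟩` for every polynomial `P`. -/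
def IsSpectralMeasureAt [DecidableEq V] [∀ v, Fintype {e : E // G.o e = v}] (q : ℕ) (x : V)
    (μ : ProbabilityMeasure ℝ) : Prop :=
  (∃ R : ℝ, (μ : Measure ℝ) (Set.Icc (-R) R) = 1) ∧
    ∀ P : Polynomial ℝ, ∫ y, P.eval y ∂(μ : Measure ℝ) =
      Polynomial.aeval ((√(q : ℝ))⁻¹ • G.adjOperator) P (Pi.single x 1) x

/-! ## Random lifts -/

/-- Colors of `G` by permutations of `n` elements: maps `σ` from the directed edges to the
symmetric group such that `σ (inv e) = (σ e)⁻¹`. -/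
def Coloring (n : ℕ) : Type _ :=
  {σ : E → Equiv.Perm (Fin n) // ∀ e, σ (G.inv e) = (σ e)⁻¹}

instance (n : ℕ) : MeasurableSpace (G.Coloring n) := ⊤

/-- The `n`-lift of `G` given by a color `σ`: its vertices are the pairs `(v, i)` with `v` a vertex
of `G` and `1 ≤ i ≤ n`, and every directed edge `e` of `G` from `u` to `v` is lifted to `n` directed
edges, from `(u, i)` to `(v, σ e i)`. -/
def lift {n : ℕ} (σ : G.Coloring n) : SerreGraph (V × Fin n) (E × Fin n) where
  o p := (G.o p.1, p.2)
  t p := (G.t p.1, σ.1 p.1 p.2)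
  inv p := (G.inv p.1, σ.1 p.1 p.2)
  inv_inv p := by simp [G.inv_inv, σ.2]
  inv_ne p h := G.inv_ne p.1 (congrArg Prod.fst h)
  o_inv p := by simp [G.o_inv]

end SerreGraph

/-! ## The regular tree -/

/-- Multiplication of a word in the alphabet `{0, …, q}` by the letter `i`, where each letter is its
own inverse. -/
def wordStep {q : ℕ} (i : Fin (q + 1)) : List (Fin (q + 1)) → List (Fin (q + 1))
  | [] => [i]
  | j :: l => if i = j then l else i :: j :: l

/-- Reduced words in the alphabet `{0, …, q}`: no letter occurs twice in a row. -/
abbrev ReducedWord (q : ℕ) : Type := {l : List (Fin (q + 1)) // l.IsChain (· ≠ ·)}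

theorem isChain_wordStep {q : ℕ} (i : Fin (q + 1)) (l : List (Fin (q + 1)))
    (hl : l.IsChain (· ≠ ·)) : (wordStep i l).IsChain (· ≠ ·) := by
  cases l with
  | nil => simp [wordStep]
  | cons j l =>
    by_cases h : i = j
    · simpa [wordStep, h] using hl.tail
    · simpa [wordStep, h] using hl

theorem wordStep_wordStep {q : ℕ} (i : Fin (q + 1)) (l : List (Fin (q + 1)))
    (hl : l.IsChain (· ≠ ·)) : wordStep i (wordStep i l) = l := by
  cases l with
  | nil => simp [wordStep]
  | cons j l =>
    by_cases h : i = j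
    · subst h
      cases l with
      | nil => simp [wordStep]
      | cons k l =>
        have hk : i ≠ k := by simpa using (List.isChain_cons_cons.1 hl).1
        simp [wordStep, hk]
    · simp [wordStep, h]

theorem wordStep_ne {q : ℕ} (i : Fin (q + 1)) (l : List (Fin (q + 1))) : wordStep i l ≠ l := by
  intro h
  have := congrArg List.length h
  cases l with
  | nil => simp [wordStep] at this
  | cons j l =>
    by_cases hij : i = j
    · simp [wordStep, hij] at this
    · simp [wordStep, hij] at this

/-- Multiplication of a reduced word by a letter. -/
def ReducedWord.step {q : ℕ} (i : Fin (q + 1)) (w : ReducedWord q) : ReducedWord q :=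
  ⟨wordStep i w.1, isChain_wordStep i w.1 w.2⟩

theorem ReducedWord.step_step {q : ℕ} (i : Fin (q + 1)) (w : ReducedWord q) :
    (w.step i).step i = w :=
  Subtype.ext (wordStep_wordStep i w.1 w.2)

/-- The `(q+1)`-regular tree, as the Cayley graph of the free product of `q + 1` copies of `ℤ/2`:
the vertices are the reduced words, and the neighbours of a word `w` are the words obtained from `w`
by adding a letter different from its first letter, or by deleting its first letter. The directed
edge `(w, i)` leads from `w` to the product of `w` by the letter `i`. -/
def regularTree (q : ℕ) : SerreGraph (ReducedWord q) (ReducedWord q × Fin (q + 1)) where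
  o p := p.1
  t p := p.1.step p.2
  inv p := (p.1.step p.2, p.2)
  inv_inv p := by simp [ReducedWord.step_step]
  inv_ne p h := wordStep_ne p.2 p.1.1 (congrArg Subtype.val (congrArg Prod.fst h))
  o_inv _ := rfl

/-- The directed edges with a given origin in the regular tree correspond to the letters. -/
def regularTreeEquiv (q : ℕ) (w : ReducedWord q) :
    Fin (q + 1) ≃ {e : ReducedWord q × Fin (q + 1) // (regularTree q).o e = w} where
  toFun i := ⟨(w, i), rfl⟩
  invFun e := e.1.2
  left_inv _ := rfl
  right_inv := by rintro ⟨⟨w', i⟩, rfl⟩; rfl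

instance (q : ℕ) (w : ReducedWord q) :
    Fintype {e : ReducedWord q × Fin (q + 1) // (regularTree q).o e = w} :=
  Fintype.ofEquiv _ (regularTreeEquiv q w)

theorem regularTree_isRegular (q : ℕ) : (regularTree q).IsRegular (q + 1) := fun w => by
  rw [← Nat.card_congr (regularTreeEquiv q w)]; simp

/-- The root of the regular tree, i.e. the empty word. -/
def treeRoot (q : ℕ) : ReducedWord q := ⟨[], by simp⟩

theorem regularTree_adjOperator (q : ℕ) (f : ReducedWord q → ℝ) (w : ReducedWord q) :
    (regularTree q).adjOperator f w = ∑ i, f (w.step i) :=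
  (Fintype.sum_equiv (regularTreeEquiv q w) _ _ fun _ => rfl).symm

/-! ## The Kesten–McKay distribution -/

/-- Spectral measure of a bounded self-adjoint operator at a unit vector. -/
theorem exists_spectralMeasure {H : Type*} [NormedAddCommGroup H] [InnerProductSpace ℂ H]
    [CompleteSpace H] (T : H →L[ℂ] H) (hT : IsSelfAdjoint T) (x : H) (hx : ‖x‖ = 1) :
    ∃ μ : ProbabilityMeasure ℝ, (∃ R : ℝ, (μ : Measure ℝ) (Set.Icc (-R) R) = 1) ∧
      ∀ P : Polynomial ℝ, ∫ y, P.eval y ∂(μ : Measure ℝ) =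
        (inner ℂ x (Polynomial.aeval T (P.map (algebraMap ℝ ℂ)) x)).re := by
  have : CompactSpace (spectrum ℝ T) :=
    ContinuousFunctionalCalculus.compactSpace_spectrum (p := IsSelfAdjoint) T
  let Λ₀ : CompactlySupportedContinuousMap (spectrum ℝ T) ℝ →ₗ[ℝ] ℝ :=
    { toFun := fun f => (inner ℂ x (cfcHom hT (f : C(spectrum ℝ T, ℝ)) x)).re
      map_add' := fun f g => by
        have : ((f + g : CompactlySupportedContinuousMap (spectrum ℝ T) ℝ) :
          C(spectrum ℝ T, ℝ)) = (f : C(spectrum ℝ T, ℝ)) + g := rfl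
        rw [this, map_add]; simp
      map_smul' := fun c f => by
        have : ((c • f : CompactlySupportedContinuousMap (spectrum ℝ T) ℝ) :
          C(spectrum ℝ T, ℝ)) = c • (f : C(spectrum ℝ T, ℝ)) := rfl
        rw [this, map_smul]; simp [inner_smul_right_eq_smul] }
  let Λ := PositiveLinearMap.mk₀ Λ₀ (fun f hf => by
    have h : 0 ≤ cfcHom hT (f : C(spectrum ℝ T, ℝ)) := by
      rw [cfcHom_nonneg_iff]; exact fun a => hf a
    have := ((ContinuousLinearMap.nonneg_iff_isPositive _).1 h).inner_nonneg_right x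
    exact (Complex.le_def.1 this).1)
  have key : ∀ f : C(spectrum ℝ T, ℝ), ∫ y, f y ∂(RealRMK.rieszMeasure Λ) =
      (inner ℂ x (cfcHom hT f x)).re := fun f =>
    RealRMK.integral_rieszMeasure Λ (CompactlySupportedContinuousMap.continuousMapEquiv f)
  have hfin : IsFiniteMeasure (RealRMK.rieszMeasure Λ) :=
    ⟨(isCompact_univ).measure_lt_top⟩
  have h1 := key 1
  rw [map_one] at h1
  have hprob : IsProbabilityMeasure (RealRMK.rieszMeasure Λ) := by
    have h2 : ((RealRMK.rieszMeasure Λ).real Set.univ) = 1 := by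
      simpa [inner_self_eq_norm_sq_to_K, hx] using h1
    constructor
    rw [measureReal_def] at h2
    rwa [ENNReal.toReal_eq_one_iff] at h2
  have hm : Measurable (Subtype.val : spectrum ℝ T → ℝ) := measurable_subtype_coe
  refine ⟨⟨(RealRMK.rieszMeasure Λ).map Subtype.val,
    Measure.isProbabilityMeasure_map hm.aemeasurable⟩, ⟨‖T‖ * ‖(1 : H →L[ℂ] H)‖, ?_⟩, fun P => ?_⟩
  · change ((RealRMK.rieszMeasure Λ).map Subtype.val) _ = 1
    rw [Measure.map_apply hm measurableSet_Icc]
    convert (measure_univ (μ := RealRMK.rieszMeasure Λ))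
    ext y
    simpa [abs_le] using spectrum.norm_le_norm_mul_of_mem y.2
  · change ∫ y, P.eval y ∂((RealRMK.rieszMeasure Λ).map Subtype.val) = _
    rw [integral_map hm.aemeasurable P.continuous.aestronglyMeasurable]
    have := key (P.toContinuousMapOn (spectrum ℝ T))
    rw [Polynomial.aeval_map_algebraMap, ← cfc_polynomial P T hT, cfc_apply (fun y => P.eval y) T hT P.continuous.continuousOn]
    exact this

/-- A permutation of an index set acts on the square summable families. -/
def l2Perm {W : Type*} (e : Equiv.Perm W) :
    lp (fun _ : W => ℂ) 2 →L[ℂ] lp (fun _ : W => ℂ) 2 :=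
  LinearMap.mkContinuous
    { toFun := fun f => ⟨fun w => f (e w), by
        have := (memℓp_gen_iff (by simp)).1 (lp.memℓp f)
        refine (memℓp_gen_iff (E := fun _ : W => ℂ) (by simp)).2 ?_
        exact (e.summable_iff (f := fun w => ‖f w‖ ^ (2 : ENNReal).toReal)).2 this⟩
      map_add' := fun f g => rfl
      map_smul' := fun c f => rfl } 1 (fun f => by
        rw [lp.norm_eq_tsum_rpow (by simp), lp.norm_eq_tsum_rpow (by simp), one_mul]
        refine le_of_eq (congrArg (· ^ _) ?_)
        exact e.tsum_eq (fun w => ‖f w‖ ^ (2 : ENNReal).toReal))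

theorem l2Perm_apply {W : Type*} (e : Equiv.Perm W) (f : lp (fun _ : W => ℂ) 2) (w : W) :
    l2Perm e f w = f (e w) := rfl

theorem isSelfAdjoint_l2Perm {W : Type*} (e : Equiv.Perm W) (he : ∀ w, e (e w) = w) :
    IsSelfAdjoint (l2Perm e) := by
  rw [ContinuousLinearMap.isSelfAdjoint_iff_isSymmetric]
  intro f g
  change inner ℂ (l2Perm e f) g = inner ℂ f (l2Perm e g)
  rw [lp.inner_eq_tsum, lp.inner_eq_tsum, ← e.tsum_eq]
  simp [l2Perm_apply, he]

theorem exists_isSpectralMeasureAt_regularTree (q : ℕ) :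
    ∃ μ : ProbabilityMeasure ℝ, (regularTree q).IsSpectralMeasureAt q (treeRoot q) μ := by
  let e : Fin (q + 1) → Equiv.Perm (ReducedWord q) := fun i =>
    ⟨ReducedWord.step i, ReducedWord.step i, fun w => w.step_step i, fun w => w.step_step i⟩
  let T : lp (fun _ : ReducedWord q => ℂ) 2 →L[ℂ] lp (fun _ : ReducedWord q => ℂ) 2 :=
    ((√(q : ℝ))⁻¹ : ℂ) • ∑ i, l2Perm (e i)
  have hT : IsSelfAdjoint T := by
    refine IsSelfAdjoint.smul (by simp [isSelfAdjoint_iff]) (isSelfAdjoint_sum _ fun i _ => ?_)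
    exact isSelfAdjoint_l2Perm (e i) fun w => w.step_step i
  let x : lp (fun _ : ReducedWord q => ℂ) 2 := lp.single 2 (treeRoot q) (1 : ℂ)
  obtain ⟨μ, hR, hμ⟩ := exists_spectralMeasure T hT x (by simp [x, lp.norm_single])
  refine ⟨μ, hR, fun P => ?_⟩
  rw [hμ P]
  set S : Module.End ℝ (ReducedWord q → ℝ) := (√(q : ℝ))⁻¹ • (regularTree q).adjOperator with hS
  have hstep : ∀ (f : lp (fun _ : ReducedWord q => ℂ) 2) (g : ReducedWord q → ℝ),
      (∀ w, f w = (g w : ℂ)) → ∀ w, T f w = (S g w : ℂ) := by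
    intro f g hfg w
    have : T f w = ((√(q : ℝ))⁻¹ : ℂ) * ∑ i, f ((e i) w) := by
      change ((√(q : ℝ))⁻¹ : ℂ) * ((∑ i, l2Perm (e i)) f : ReducedWord q → ℂ) w = _
      rw [sum_apply, lp.coeFn_sum, Finset.sum_apply]
      rfl
    rw [this, hS, LinearMap.smul_apply, Pi.smul_apply, regularTree_adjOperator]
    simp [hfg, e]
  have hpow : ∀ r w, (T ^ r) x w = (((S ^ r) (Pi.single (treeRoot q) 1) w : ℝ) : ℂ) := by
    intro r
    induction r with
    | zero =>
      intro w
      by_cases h : w = treeRoot q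
      · subst h; simp [x]
      · simp [x, h]
    | succ r ih =>
      intro w
      rw [pow_succ', pow_succ']
      exact hstep _ _ ih w
  have hP : (Polynomial.aeval T (P.map (algebraMap ℝ ℂ)) x) (treeRoot q) =
      ((Polynomial.aeval S P (Pi.single (treeRoot q) 1) (treeRoot q) : ℝ) : ℂ) := by
    rw [Polynomial.aeval_eq_sum_range, Polynomial.aeval_eq_sum_range, Polynomial.natDegree_map,
      sum_apply, lp.coeFn_sum, Finset.sum_apply]
    simp only [smul_apply, lp.coeFn_smul, Pi.smul_apply, hpow]
    simp
  have hin : inner ℂ x (Polynomial.aeval T (P.map (algebraMap ℝ ℂ)) x) =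
      (Polynomial.aeval T (P.map (algebraMap ℝ ℂ)) x) (treeRoot q) := by
    simp [x, lp.inner_single_left]
  rw [hin, hP, Complex.ofReal_re]

/-- The Kesten–McKay distribution `μ_q`: the normalized spectral measure of the `(q+1)`-regular
tree, i.e. the probability measure of bounded support on `ℝ` with
`∫ P dμ_q = ⟨1ₓ, P(q^{-1/2} A) 1ₓ⟩` for every polynomial `P`, where `x` is the root and `A` the
adjacency operator. (These conditions determine it.) -/
def kestenMcKay (q : ℕ) : ProbabilityMeasure ℝ :=
  (exists_isSpectralMeasureAt_regularTree q).choose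

theorem kestenMcKay_spec (q : ℕ) :
    (regularTree q).IsSpectralMeasureAt q (treeRoot q) (kestenMcKay q) :=
  (exists_isSpectralMeasureAt_regularTree q).choose_spec

/-! ## Weak convergence in probability -/

/-- `d` is a metric on the set of probability measures on `ℝ` for which convergence of sequences is
weak convergence. -/
structure IsWeakMetric (d : ProbabilityMeasure ℝ → ProbabilityMeasure ℝ → ℝ) : Prop where
  eq_zero_iff : ∀ μ ν, d μ ν = 0 ↔ μ = ν
  symm : ∀ μ ν, d μ ν = d ν μ
  triangle : ∀ μ ν ρ, d μ ρ ≤ d μ ν + d ν ρ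
  tendsto_iff : ∀ (μ : ℕ → ProbabilityMeasure ℝ) (ν : ProbabilityMeasure ℝ),
    Tendsto (fun n => d (μ n) ν) atTop (𝓝 0) ↔
      ∀ f : BoundedContinuousFunction ℝ ℝ,
        Tendsto (fun n => ∫ x, f x ∂(μ n : Measure ℝ)) atTop (𝓝 (∫ x, f x ∂(ν : Measure ℝ)))

/-- Such metrics exist: the Lévy–Prokhorov metric is one. -/
theorem isWeakMetric_levyProkhorov :
    IsWeakMetric fun μ ν => levyProkhorovDist (μ : Measure ℝ) (ν : Measure ℝ) where
  eq_zero_iff μ ν := by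
    have h := dist_eq_zero (x := LevyProkhorov.ofMeasure μ) (y := LevyProkhorov.ofMeasure ν)
    rw [LevyProkhorov.dist_probabilityMeasure_def] at h
    simpa using h
  symm μ ν := levyProkhorovDist_comm _ _
  triangle μ ν ρ := levyProkhorovDist_triangle _ _ _
  tendsto_iff μ ν := by
    rw [← ProbabilityMeasure.tendsto_iff_forall_integral_tendsto,
      (LevyProkhorov.probabilityMeasureHomeomorph (Ω := ℝ)).isInducing.tendsto_nhds_iff,
      tendsto_iff_dist_tendsto_zero (f := _ ∘ _)]
    rfl

/-- Random probability measures `X i` on `ℝ`, defined on probability spaces `(Ω i, P i)`, converge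
weakly in probability to `ν` along the filter `l`: for every metric `d` of weak convergence and
every `ε > 0`, the probability that `d (X i) ν > ε` tends to `0`. -/
def ConvergesWeaklyInProbability {ι : Type*} (l : Filter ι) {Ω : ι → Type*}
    [∀ i, MeasurableSpace (Ω i)] (P : ∀ i, Measure (Ω i)) (X : ∀ i, Ω i → ProbabilityMeasure ℝ)
    (ν : ProbabilityMeasure ℝ) : Prop :=
  ∀ d, IsWeakMetric d → ∀ ε : ℝ, 0 < ε → Tendsto (fun i => P i {ω | ε < d (X i ω) ν}) l (𝓝 0)

end

noncomputable section

/-! ## Return numbers of the regular tree -/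

/-! The proof is the method of moments. By Gershgorin all the measures live on one compact interval,
where polynomials are dense, so by `IsWeakMetric.exists_moments` it suffices that each moment
converges in probability.

Up to the factor `q^(-k/2)`, the `k`-th moment of a lift is the average over `(v, i)` of the number
of closed walks of length `k` at `(v, i)`. Such a walk is a walk in `G` that returns to `v` and
whose permutations, composed, fix `i`. Walks that reduce to the empty walk close up in every lift;
by `sum_walks_reduce_eq_nil` their number is the return number of the tree, so they contribute
exactly the Kesten–McKay moment. The error is therefore nonnegative and comes only from walks with
nonempty reduction.

A reduced nonempty walk of length at most `k` fixes a given `i` with probability at most `k² / (n -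
k)` (`card_fixed_mul_le`), since it must revisit a position in the fibre. The bound comes from a
switching argument (`card_collision_mul_le`): if the first collision occurs at the last edge,
redirecting that edge to any unvisited position yields many colorings, and each of them arises from
few collisions. With `(q + 1)^k` walks per vertex the mean error is `O(1/n)`, and Markov's
inequality and a union bound over finitely many moments conclude. -/

/-- The number of walks of length `k` in the `(q+1)`-regular tree from a vertex at distance `m` of
the root to the root. -/
def returnCount (q : ℕ) : ℕ → ℕ → ℝ
  | 0, 0 => 1
  | 0, _ + 1 => 0
  | k + 1, 0 => (q + 1) * returnCount q k 1
  | k + 1, m + 1 => q * returnCount q k (m + 2) + returnCount q k m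

/-- Powers of the adjacency operator keep the indicator of the root radial, so only the word length
matters. -/
theorem regularTree_adjOperator_pow_single (q k : ℕ) (w : ReducedWord q) :
    ((regularTree q).adjOperator ^ k) (Pi.single (treeRoot q) 1) w =
      returnCount q k w.1.length := by
  induction k generalizing w with
  | zero =>
    obtain ⟨_ | ⟨j, l⟩, hl⟩ := w
    · exact Pi.single_eq_same (M := fun _ => ℝ) (treeRoot q) (1 : ℝ)
    · exact Pi.single_eq_of_ne (M := fun _ => ℝ) (i := treeRoot q)
        (i' := ⟨j :: l, hl⟩) (fun h => List.cons_ne_nil j l (congrArg Subtype.val h)) (1 : ℝ)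
  | succ k ih =>
    rw [pow_succ', Module.End.mul_apply, regularTree_adjOperator]
    simp only [ih]
    obtain ⟨_ | ⟨j, l⟩, hl⟩ := w
    · simp [ReducedWord.step, wordStep, returnCount]
    -- The letter `j` deletes the first letter; each of the other `q` letters lengthens the word.
    · rw [← Finset.add_sum_erase _ _ (Finset.mem_univ j), Finset.sum_congr rfl
        (g := fun _ => returnCount q k (l.length + 2))]
      · simp only [ReducedWord.step, wordStep, if_true, List.length_cons, returnCount]
        simp [add_comm (returnCount q k l.length)]
      · intro i hi
        simp [ReducedWord.step, wordStep, Finset.ne_of_mem_erase hi]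

namespace SerreGraph

variable {V E : Type*} (G : SerreGraph V E)

/-! ## Walks and their reduction -/

/-- The edges with a given origin. -/
def edgesFrom [Fintype E] [DecidableEq V] (v : V) : Finset E :=
  Finset.univ.filter fun e => G.o e = v

theorem mem_edgesFrom [Fintype E] [DecidableEq V] {v : V} {e : E} :
    e ∈ G.edgesFrom v ↔ G.o e = v := by simp [edgesFrom]

theorem card_edgesFrom [Fintype E] [DecidableEq V] {d : ℕ} (hG : G.IsRegular d) (v : V) :
    (G.edgesFrom v).card = d := by
  rw [← hG v, Nat.card_eq_fintype_card, Fintype.card_subtype]; rfl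

/-- The list of edges `l` is a walk from `v`. -/
def IsWalkFrom : V → List E → Prop
  | _, [] => True
  | v, e :: l => G.o e = v ∧ IsWalkFrom (G.t e) l

/-- The terminal vertex of a walk from `v`. -/
def terminal : V → List E → V
  | v, [] => v
  | _, e :: l => terminal (G.t e) l

/-- The walks of length `k` from `v`. -/
def walks [Fintype E] [DecidableEq V] [DecidableEq E] : ℕ → V → Finset (List E)
  | 0, _ => {[]}
  | k + 1, v => (G.edgesFrom v).biUnion fun e => (walks k (G.t e)).image (List.cons e)

section

variable [Fintype E] [DecidableEq V] [DecidableEq E]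

theorem mem_walks {k : ℕ} {v : V} {l : List E} :
    l ∈ G.walks k v ↔ l.length = k ∧ G.IsWalkFrom v l := by
  induction k generalizing v l with
  | zero => cases l <;> simp [walks, IsWalkFrom]
  | succ k ih =>
    cases l with
    | nil => simp [walks]
    | cons e l => simp [walks, mem_edgesFrom, ih, IsWalkFrom]; tauto

theorem sum_walks_succ (k : ℕ) (v : V) (F : List E → ℝ) :
    ∑ l ∈ G.walks (k + 1) v, F l =
      ∑ e ∈ G.edgesFrom v, ∑ l ∈ G.walks k (G.t e), F (e :: l) := by
  rw [walks, Finset.sum_biUnion]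
  · refine Finset.sum_congr rfl fun e _ => ?_
    rw [Finset.sum_image (fun a _ b _ h => (List.cons.inj h).2)]
  · intro a _ b _ hab
    rw [Function.onFun, Finset.disjoint_left]
    intro l hl hl'
    obtain ⟨x, -, rfl⟩ := Finset.mem_image.1 hl
    obtain ⟨y, -, h⟩ := Finset.mem_image.1 hl'
    exact hab (List.cons.inj h).1.symm

theorem card_walks {d : ℕ} (hG : G.IsRegular d) (k : ℕ) (v : V) :
    ((G.walks k v).card : ℝ) = (d : ℝ) ^ k := by
  have h : ((G.walks k v).card : ℝ) = ∑ l ∈ G.walks k v, (1 : ℝ) := by simp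
  rw [h]
  clear h
  induction k generalizing v with
  | zero => simp [walks]
  | succ k ih =>
    rw [sum_walks_succ]
    simp only [ih]
    simp [G.card_edgesFrom hG, pow_succ']

end

/-- Append the edge `e` to a reduced walk, recorded with its last edge first, and reduce. -/
def push [DecidableEq E] : List E → E → List E
  | [], e => [e]
  | a :: s, e => if e = G.inv a then s else e :: a :: s

/-- The walk `s`, recorded with its last edge first, has no backtracking. -/
def IsReduced (s : List E) : Prop := s.IsChain fun e a => e ≠ G.inv a

/-- The current vertex of a walk from `v` recorded with its last edge first. -/
def tip (v : V) : List E → V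
  | [] => v
  | a :: _ => G.t a

/-- The list of edges `s` is a walk from `v` recorded with its last edge first. -/
def IsRevWalkFrom (v : V) : List E → Prop
  | [] => True
  | a :: s => G.o a = G.tip v s ∧ IsRevWalkFrom v s

section

variable [DecidableEq E]

theorem IsReduced.push {s : List E} (hs : G.IsReduced s) (e : E) : G.IsReduced (G.push s e) := by
  unfold IsReduced at *
  cases s with
  | nil => simp [SerreGraph.push]
  | cons a s =>
    by_cases h : e = G.inv a
    · simpa [SerreGraph.push, h] using hs.tail
    · simpa [SerreGraph.push, h] using hs

theorem IsReduced.foldl_push {s : List E} (hs : G.IsReduced s) (l : List E) :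
    G.IsReduced (l.foldl G.push s) := by
  induction l generalizing s with
  | nil => exact hs
  | cons e l ih => exact ih (hs.push G e)

theorem length_push_le (s : List E) (e : E) : (G.push s e).length ≤ s.length + 1 := by
  cases s with
  | nil => simp [push]
  | cons a s => simp only [push]; split_ifs <;> grind

theorem length_foldl_push_le (s l : List E) :
    (l.foldl G.push s).length ≤ s.length + l.length := by
  induction l generalizing s with
  | nil => simp
  | cons e l ih =>
    have := ih (G.push s e)
    have := G.length_push_le s e
    simp only [List.foldl_cons, List.length_cons]
    omega

variable {G}

theorem IsRevWalkFrom.push {v : V} {s : List E} (hs : G.IsRevWalkFrom v s) {e : E}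
    (he : G.o e = G.tip v s) :
    G.IsRevWalkFrom v (G.push s e) ∧ G.tip v (G.push s e) = G.t e := by
  cases s with
  | nil => exact ⟨⟨he, trivial⟩, rfl⟩
  | cons a s =>
    by_cases h : e = G.inv a
    · subst h
      simp only [SerreGraph.push, if_true]
      exact ⟨hs.2, by rw [G.t_inv]; exact hs.1.symm⟩
    · simp only [SerreGraph.push, if_neg h]
      exact ⟨⟨he, hs⟩, rfl⟩

/-- Cancelling a backtracking does not move the endpoint; in particular a walk that reduces to the
empty walk is closed. -/
theorem IsRevWalkFrom.terminal_eq {v : V} {s : List E} (hs : G.IsRevWalkFrom v s) {l : List E}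
    (hl : G.IsWalkFrom (G.tip v s) l) :
    G.terminal (G.tip v s) l = G.tip v (l.foldl G.push s) := by
  induction l generalizing s with
  | nil => rfl
  | cons e l ih =>
    obtain ⟨h1, h2⟩ := hs.push hl.1
    rw [List.foldl_cons, ← ih h1 (h2 ▸ hl.2), h2]
    rfl

/-- The number of walks in a regular graph which reduce to the trivial walk. -/
theorem sum_walks_reduce_eq_nil [Fintype E] [DecidableEq V] {q : ℕ} (hG : G.IsRegular (q + 1))
    (k : ℕ) {v : V} {s : List E} (hs : G.IsRevWalkFrom v s) :
    ∑ l ∈ G.walks k (G.tip v s), (if l.foldl G.push s = [] then (1 : ℝ) else 0) =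
      returnCount q k s.length := by
  induction k generalizing s with
  | zero =>
    rw [walks, Finset.sum_singleton]
    cases s <;> simp [returnCount]
  | succ k ih =>
    rw [sum_walks_succ]
    have hstep : ∀ e ∈ G.edgesFrom (G.tip v s), ∑ l ∈ G.walks k (G.t e),
        (if (e :: l).foldl G.push s = [] then (1 : ℝ) else 0) =
          returnCount q k (G.push s e).length := by
      intro e he
      obtain ⟨h1, h2⟩ := hs.push (G.mem_edgesFrom.1 he)
      rw [← ih h1, h2]
      rfl
    rw [Finset.sum_congr rfl hstep]
    have hcard := G.card_edgesFrom hG (G.tip v s)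
    cases s with
    | nil => simp [push, hcard, returnCount]
    | cons a s =>
      -- Of the `q + 1` edges leaving the tip exactly one, `inv a`, cancels the last edge. This is
      -- the recursion of `returnCount`, so no covering map from the tree is needed.
      have ha : G.inv a ∈ G.edgesFrom (G.tip v (a :: s)) := G.mem_edgesFrom.2 (G.o_inv a)
      rw [← Finset.add_sum_erase _ _ ha, Finset.sum_congr rfl
        (g := fun _ => returnCount q k (s.length + 2))]
      · simp [push, returnCount, Finset.card_erase_of_mem ha, hcard, add_comm]
      · intro e he
        simp [push, Finset.ne_of_mem_erase he]

end

/-! ## Adjacency matrices and walks in lifts -/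

theorem adjMatrix_mulVec [Fintype V] [DecidableEq V] [Fintype E] (f : V → ℝ) (v : V) :
    G.adjMatrix.mulVec f v = ∑ e ∈ G.edgesFrom v, f (G.t e) := by
  classical
  rw [Matrix.mulVec, dotProduct, ← Finset.sum_fiberwise (G.edgesFrom v) G.t]
  refine Finset.sum_congr rfl fun u _ => ?_
  rw [Finset.sum_congr rfl (g := fun _ => f u)
    (fun e he => by rw [(Finset.mem_filter.1 he).2]), Finset.sum_const, nsmul_eq_mul]
  congr 1
  rw [adjMatrix, Matrix.of_apply, Nat.card_eq_fintype_card, Fintype.card_subtype]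
  congr 2
  ext e
  simp [mem_edgesFrom]

theorem isRegular_lift {n d : ℕ} (hG : G.IsRegular d) (σ : G.Coloring n) :
    (G.lift σ).IsRegular d := by
  rintro ⟨v, i⟩
  rw [← hG v]
  refine Nat.card_congr ⟨fun e => ⟨e.1.1, congrArg Prod.fst e.2⟩,
    fun e => ⟨(e.1, i), Prod.ext e.2 rfl⟩, ?_, fun e => rfl⟩
  rintro ⟨⟨e, j⟩, h⟩
  have : i = j := (congrArg Prod.snd h).symm
  subst this
  rfl

/-- The action of a walk on the fibre of a lift. -/
def walkAct {n : ℕ} (σ : G.Coloring n) (l : List E) (i : Fin n) : Fin n :=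
  l.foldl (fun i e => σ.1 e i) i

/-- The action on the fibre of a walk recorded with its last edge first. -/
def revAct {n : ℕ} (σ : G.Coloring n) (i : Fin n) : List E → Fin n
  | [] => i
  | a :: s => σ.1 a (revAct σ i s)

theorem revAct_push [DecidableEq E] {n : ℕ} (σ : G.Coloring n) (i : Fin n) (s : List E) (e : E) :
    G.revAct σ i (G.push s e) = σ.1 e (G.revAct σ i s) := by
  cases s with
  | nil => rfl
  | cons a s =>
    by_cases h : e = G.inv a
    · subst h; simp [push, revAct, σ.2]
    · simp [push, revAct, h]

/-- Mutually inverse edges carry inverse permutations, so the action of a walk on the fibre depends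
only on its reduction. -/
theorem walkAct_revAct [DecidableEq E] {n : ℕ} (σ : G.Coloring n) (i : Fin n) (s l : List E) :
    G.walkAct σ l (G.revAct σ i s) = G.revAct σ i (l.foldl G.push s) := by
  induction l generalizing s with
  | nil => rfl
  | cons e l ih =>
    rw [List.foldl_cons, ← ih, revAct_push]
    rfl

theorem sum_edgesFrom_lift [Fintype E] [DecidableEq V] {n : ℕ} (σ : G.Coloring n) (v : V)
    (i : Fin n) (F : E × Fin n → ℝ) :
    ∑ e ∈ (G.lift σ).edgesFrom (v, i), F e = ∑ e ∈ G.edgesFrom v, F (e, i) := by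
  refine Finset.sum_bij' (fun e _ => e.1) (fun e _ => (e, i)) ?_ ?_ ?_ ?_ ?_
  · intro e he
    exact G.mem_edgesFrom.2 (congrArg Prod.fst ((G.lift σ).mem_edgesFrom.1 he))
  · intro e he
    exact (G.lift σ).mem_edgesFrom.2 (Prod.ext (G.mem_edgesFrom.1 he) rfl)
  · rintro ⟨e, j⟩ he
    exact Prod.ext rfl (congrArg Prod.snd ((G.lift σ).mem_edgesFrom.1 he)).symm
  · intro e he; rfl
  · rintro ⟨e, j⟩ he
    rw [show j = i from congrArg Prod.snd ((G.lift σ).mem_edgesFrom.1 he)]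

/-- Unique path lifting: a walk in the lift is determined by its starting point and its projection
to `G`. -/
theorem adjMatrix_lift_pow_mulVec [Fintype V] [DecidableEq V] [Fintype E] [DecidableEq E]
    {n : ℕ} (σ : G.Coloring n) (f : V × Fin n → ℝ) (k : ℕ) (v : V) (i : Fin n) :
    ((G.lift σ).adjMatrix ^ k).mulVec f (v, i) =
      ∑ l ∈ G.walks k v, f (G.terminal v l, G.walkAct σ l i) := by
  induction k generalizing v i with
  | zero => simp [walks, terminal, walkAct]
  | succ k ih =>
    rw [pow_succ', ← Matrix.mulVec_mulVec, adjMatrix_mulVec, sum_edgesFrom_lift, sum_walks_succ]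
    refine Finset.sum_congr rfl fun e _ => ?_
    exact ih _ _

theorem adjMatrix_lift_pow_apply_self [Fintype V] [DecidableEq V] [Fintype E] [DecidableEq E]
    {n : ℕ} (σ : G.Coloring n) (k : ℕ) (v : V) (i : Fin n) :
    ((G.lift σ).adjMatrix ^ k) (v, i) (v, i) =
      ∑ l ∈ G.walks k v, if G.terminal v l = v ∧ G.walkAct σ l i = i then 1 else 0 := by
  have := G.adjMatrix_lift_pow_mulVec σ (Pi.single (v, i) 1) k v i
  rw [Matrix.mulVec_single_one] at this
  simpa [Pi.single_apply] using this

/-- Walks that reduce to the empty walk close up for every `σ`. This one-sided bound later removes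
the absolute value from the moment difference. -/
theorem returnCount_le_adjMatrix_lift_pow [Fintype V] [DecidableEq V] [Fintype E] [DecidableEq E]
    {q : ℕ} (hG : G.IsRegular (q + 1)) {n : ℕ} (σ : G.Coloring n) (k : ℕ) (v : V) (i : Fin n) :
    returnCount q k 0 ≤ ((G.lift σ).adjMatrix ^ k) (v, i) (v, i) := by
  rw [adjMatrix_lift_pow_apply_self,
    ← List.length_nil (α := E), ← sum_walks_reduce_eq_nil hG k (v := v) (s := []) trivial]
  refine Finset.sum_le_sum fun l hl => ?_
  split_ifs with h1 h2
  · exact le_rfl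
  · refine absurd ⟨?_, ?_⟩ h2
    · have := IsRevWalkFrom.terminal_eq (G := G) (v := v) (s := []) trivial
        (G.mem_walks.1 hl).2
      rwa [h1] at this
    · have := G.walkAct_revAct σ i [] l
      rwa [h1] at this
  · exact zero_le_one
  · exact le_rfl

theorem adjMatrix_lift_pow_le [Fintype V] [DecidableEq V] [Fintype E] [DecidableEq E]
    {q : ℕ} (hG : G.IsRegular (q + 1)) {n : ℕ} (σ : G.Coloring n) (k : ℕ) (v : V) (i : Fin n) :
    ((G.lift σ).adjMatrix ^ k) (v, i) (v, i) ≤ returnCount q k 0 +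
      ∑ l ∈ G.walks k v, if l.foldl G.push [] ≠ [] ∧ G.revAct σ i (l.foldl G.push []) = i
        then 1 else 0 := by
  rw [adjMatrix_lift_pow_apply_self,
    ← List.length_nil (α := E), ← sum_walks_reduce_eq_nil hG k (v := v) (s := []) trivial,
    tip, ← Finset.sum_add_distrib]
  refine Finset.sum_le_sum fun l hl => ?_
  have := G.walkAct_revAct σ i [] l
  rw [revAct] at this
  rw [← this]
  by_cases h1 : l.foldl G.push [] = [] <;> by_cases h2 : G.walkAct σ l i = i <;>
    by_cases h3 : G.terminal v l = v <;> simp [h1, h2, h3]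

end SerreGraph

namespace SerreGraph

variable {V E : Type*} (G : SerreGraph V E)

/-! ## Fixed points of random walks on the fibre -/

instance (n : ℕ) : Nonempty (G.Coloring n) := ⟨⟨fun _ => 1, fun _ => by simp⟩⟩

instance [Finite E] (n : ℕ) : Finite (G.Coloring n) :=
  inferInstanceAs (Finite {σ : E → Equiv.Perm (Fin n) // ∀ e, σ (G.inv e) = (σ e)⁻¹})

instance [Finite E] (n : ℕ) : Fintype (G.Coloring n) := Fintype.ofFinite _

/-- Compose the permutation at the edge `e` with `π`, and adapt the one at the inverse edge. -/
def switch [DecidableEq E] {n : ℕ} (σ : G.Coloring n) (e : E) (π : Equiv.Perm (Fin n)) :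
    G.Coloring n :=
  ⟨fun a => if a = e then π * σ.1 e else if a = G.inv e then σ.1 (G.inv e) * π⁻¹ else σ.1 a, by
    intro a
    have hne := G.inv_ne
    by_cases h1 : a = e
    · subst h1
      simp [hne, σ.2]
    · by_cases h2 : a = G.inv e
      · subst h2
        simp [hne, G.inv_inv, σ.2]
      · have h3 : G.inv a ≠ e := fun h => h2 (by rw [← h, G.inv_inv])
        have h4 : G.inv a ≠ G.inv e := fun h => h1 (by rw [← G.inv_inv a, h, G.inv_inv])
        simp [h1, h2, h3, h4, σ.2]⟩

theorem switch_switch_inv [DecidableEq E] {n : ℕ} (σ : G.Coloring n) (e : E)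
    (π : Equiv.Perm (Fin n)) : G.switch (G.switch σ e π) e π⁻¹ = σ := by
  refine Subtype.ext (funext fun a => ?_)
  have hne := G.inv_ne
  by_cases h1 : a = e
  · subst h1; simp [switch]
  · by_cases h2 : a = G.inv e
    · subst h2; simp [switch, hne]
    · simp [switch, h1, h2]

/-- The positions visited by a walk in the fibre over its vertices, last position first. -/
def revOrbit {n : ℕ} (σ : G.Coloring n) (i : Fin n) : List E → List (Fin n)
  | [] => [i]
  | a :: s => G.revAct σ i (a :: s) :: revOrbit σ i s

theorem length_revOrbit {n : ℕ} (σ : G.Coloring n) (i : Fin n) (s : List E) :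
    (G.revOrbit σ i s).length = s.length + 1 := by
  induction s with
  | nil => rfl
  | cons a s ih => simp [revOrbit, ih]

theorem revAct_mem_revOrbit {n : ℕ} (σ : G.Coloring n) (i : Fin n) {s s' : List E}
    (h : s' <:+ s) : G.revAct σ i s' ∈ G.revOrbit σ i s := by
  induction s with
  | nil => rw [List.suffix_nil] at h; simp [h, revOrbit, revAct]
  | cons a s ih =>
    rcases List.suffix_cons_iff.1 h with rfl | h
    · exact List.mem_cons_self
    · exact List.mem_cons_of_mem _ (ih h)

/-- Without repeated positions, the last position is reached only at the end of the walk. -/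
theorem eq_of_revAct_eq {n : ℕ} {σ : G.Coloring n} {i : Fin n} {s s' : List E}
    (hnd : (G.revOrbit σ i s).Nodup) (h : s' <:+ s)
    (heq : G.revAct σ i s' = G.revAct σ i s) : s' = s := by
  cases s with
  | nil => exact List.suffix_nil.1 h
  | cons a s =>
    rcases List.suffix_cons_iff.1 h with rfl | h
    · rfl
    · exact absurd (heq ▸ G.revAct_mem_revOrbit σ i h) (List.nodup_cons.1 hnd).1

section

variable [DecidableEq E] {n : ℕ} {σ : G.Coloring n} {i m : Fin n} {e : E} {s : List E}

/-- The swap affects only steps of the walk that touch the old endpoint of `e :: s` or `m`, along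
`e` or `inv e`. The position `m` is unvisited; reaching the old endpoint along `e`, or leaving it
along `inv e`, would force a repetition or a backtracking. -/
theorem revAct_switch (hred : G.IsReduced (e :: s)) (hnd : (G.revOrbit σ i s).Nodup)
    (hm : m ∉ G.revOrbit σ i s) {s' : List E} (hs' : s' <:+ s) :
    G.revAct (G.switch σ e (Equiv.swap (G.revAct σ i (e :: s)) m)) i s' = G.revAct σ i s' := by
  induction s' with
  | nil => rfl
  | cons a t ih =>
    have ht : t <:+ s := (List.suffix_cons a t).trans hs'
    have hmem := G.revAct_mem_revOrbit σ i hs'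
    have hmemt := G.revAct_mem_revOrbit σ i ht
    rw [revAct, ih ht, revAct, revAct]
    by_cases h1 : a = e
    · subst h1
      simp only [switch, if_true, Equiv.Perm.mul_apply]
      refine Equiv.swap_apply_of_ne_of_ne (fun h => ?_) (fun h => hm (h ▸ hmem))
      -- By injectivity the step along `e` would start at the last position of `s`, so `t` would be
      -- all of `s`.
      have := G.eq_of_revAct_eq hnd ht ((σ.1 a).injective h)
      have hl := hs'.length_le
      rw [this] at hl
      simp at hl
    · by_cases h2 : a = G.inv e
      · subst h2
        simp only [switch, G.inv_ne, if_false, if_true, Equiv.Perm.mul_apply, Equiv.swap_inv]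
        refine congrArg _ (Equiv.swap_apply_of_ne_of_ne (fun h => ?_) (fun h => hm (h ▸ hmemt)))
        -- The step along `inv e` would end at the last position of `s`, hence be the last edge of
        -- `s`, and `e` would backtrack.
        have h3 : G.revAct σ i (G.inv e :: t) = G.revAct σ i s := by
          rw [revAct, h]; simp [σ.2]
        have := G.eq_of_revAct_eq hnd hs' h3
        subst this
        exact (List.isChain_cons_cons.1 hred).1 (G.inv_inv e).symm
      · simp [switch, h1, h2]

theorem revOrbit_switch (hred : G.IsReduced (e :: s)) (hnd : (G.revOrbit σ i s).Nodup)
    (hm : m ∉ G.revOrbit σ i s) :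
    G.revOrbit (G.switch σ e (Equiv.swap (G.revAct σ i (e :: s)) m)) i s = G.revOrbit σ i s := by
  suffices ∀ s', s' <:+ s →
      G.revOrbit (G.switch σ e (Equiv.swap (G.revAct σ i (e :: s)) m)) i s' =
        G.revOrbit σ i s' from this s List.suffix_rfl
  intro s' hs'
  induction s' with
  | nil => rfl
  | cons a t ih =>
    rw [revOrbit, G.revAct_switch hred hnd hm hs', ih ((List.suffix_cons a t).trans hs'), revOrbit]

theorem revAct_switch_cons (hred : G.IsReduced (e :: s)) (hnd : (G.revOrbit σ i s).Nodup)
    (hm : m ∉ G.revOrbit σ i s) :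
    G.revAct (G.switch σ e (Equiv.swap (G.revAct σ i (e :: s)) m)) i (e :: s) = m := by
  rw [revAct, G.revAct_switch hred hnd hm List.suffix_rfl]
  simp [switch, revAct]

end

variable [Fintype E]

open Classical in
/-- Few colorings make a reduced walk collide with itself at its last step. -/
theorem card_collision_mul_le {n : ℕ} (i : Fin n) {e : E} {s : List E}
    (hred : G.IsReduced (e :: s)) :
    (Finset.univ.filter fun σ : G.Coloring n => (G.revOrbit σ i s).Nodup ∧
        G.revAct σ i (e :: s) ∈ G.revOrbit σ i s).card * (n - (s.length + 1)) ≤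
      Fintype.card (G.Coloring n) * (s.length + 1) := by
  set A := Finset.univ.filter fun σ : G.Coloring n => (G.revOrbit σ i s).Nodup ∧
        G.revAct σ i (e :: s) ∈ G.revOrbit σ i s with hA
  -- Double counting: a colliding coloring is paired with each unvisited position `m`. When `n` is
  -- too small, truncated subtraction makes the bound trivial.
  let S : Finset (Σ _ : G.Coloring n, Fin n) := A.sigma fun σ => (G.revOrbit σ i s).toFinsetᶜ
  have hS : S.card = A.card * (n - (s.length + 1)) := by
    rw [Finset.card_sigma, Finset.sum_const_nat]
    intro σ hσ
    rw [Finset.card_compl, Fintype.card_fin,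
      List.toFinset_card_of_nodup (Finset.mem_filter.1 hσ).2.1, length_revOrbit]
  have hT : ((Finset.univ : Finset (G.Coloring n)) ×ˢ Finset.range (s.length + 1)).card =
      Fintype.card (G.Coloring n) * (s.length + 1) := by simp
  rw [← hS, ← hT]
  let y (σ : G.Coloring n) := G.revAct σ i (e :: s)
  -- The index records which visited position was hit; it is the only information lost by switching.
  refine Finset.card_le_card_of_injOn (fun p => (G.switch p.1 e (Equiv.swap (y p.1) p.2),
    (G.revOrbit p.1 i s).idxOf (y p.1))) ?_ ?_
  · rintro ⟨σ, m⟩ hp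
    obtain ⟨hσ, -⟩ := Finset.mem_sigma.1 hp
    have := List.idxOf_lt_length_of_mem (Finset.mem_filter.1 hσ).2.2
    rw [length_revOrbit] at this
    simpa using this
  · rintro ⟨σ, m⟩ hp ⟨σ', m'⟩ hp' heq
    obtain ⟨hσ, hm⟩ := Finset.mem_sigma.1 hp
    obtain ⟨hσ', hm'⟩ := Finset.mem_sigma.1 hp'
    obtain ⟨-, hnd, hmem⟩ := Finset.mem_filter.1 hσ
    obtain ⟨-, hnd', hmem'⟩ := Finset.mem_filter.1 hσ'
    simp only [Finset.mem_compl, List.mem_toFinset] at hm hm'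
    obtain ⟨h1, h2⟩ := Prod.mk.inj heq
    -- Decoding: the switched walk ends at `m` and has the same orbit, the index then gives the old
    -- endpoint, and the inverse swap restores `σ`.
    have horb := G.revOrbit_switch hred hnd hm
    have horb' := G.revOrbit_switch hred hnd' hm'
    have hact := G.revAct_switch_cons hred hnd hm
    have hact' := G.revAct_switch_cons hred hnd' hm'
    change G.switch σ e (Equiv.swap (G.revAct σ i (e :: s)) m) =
      G.switch σ' e (Equiv.swap (G.revAct σ' i (e :: s)) m') at h1
    rw [h1] at horb hact
    have hm_eq : m = m' := hact.symm.trans hact'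
    have horb_eq : G.revOrbit σ i s = G.revOrbit σ' i s := horb.symm.trans horb'
    change (G.revOrbit σ i s).idxOf (G.revAct σ i (e :: s)) =
      (G.revOrbit σ' i s).idxOf (G.revAct σ' i (e :: s)) at h2
    rw [← horb_eq] at h2 hmem'
    have hy : G.revAct σ i (e :: s) = G.revAct σ' i (e :: s) := (List.idxOf_inj hmem).1 h2
    have hσ_eq : σ = σ' := by
      rw [← G.switch_switch_inv σ e (Equiv.swap (G.revAct σ i (e :: s)) m), h1, hy, hm_eq,
        switch_switch_inv]
    subst hσ_eq hm_eq
    rfl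

-- Union bound over the step at which the first repetition occurs.
open Classical in
theorem card_not_nodup_revOrbit_mul_le {n : ℕ} (i : Fin n) {s : List E} (hred : G.IsReduced s)
    {k : ℕ} (hk : s.length ≤ k) :
    (Finset.univ.filter fun σ : G.Coloring n => ¬ (G.revOrbit σ i s).Nodup).card * (n - k) ≤
      Fintype.card (G.Coloring n) * (s.length * k) := by
  induction s with
  | nil => simp [revOrbit]
  | cons e s ih =>
    have hs : s.length + 1 ≤ k := by simpa using hk
    have hsub : (Finset.univ.filter fun σ : G.Coloring n => ¬ (G.revOrbit σ i (e :: s)).Nodup) ⊆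
        (Finset.univ.filter fun σ : G.Coloring n => ¬ (G.revOrbit σ i s).Nodup) ∪
        (Finset.univ.filter fun σ : G.Coloring n => (G.revOrbit σ i s).Nodup ∧
          G.revAct σ i (e :: s) ∈ G.revOrbit σ i s) := by
      intro σ
      simp only [Finset.mem_filter, Finset.mem_univ, true_and, Finset.mem_union, revOrbit,
        List.nodup_cons]
      tauto
    have h1 := ih hred.tail (by omega)
    have h2 : _ * (n - k) ≤ _ :=
      -- Every step is weakened to the common factor `n - k`, so that the bounds add up.
      (Nat.mul_le_mul_left _ (by omega)).trans (G.card_collision_mul_le i hred)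
    calc _ ≤ _ := Nat.mul_le_mul_right _ ((Finset.card_le_card hsub).trans
            (Finset.card_union_le _ _))
      _ ≤ Fintype.card (G.Coloring n) * (s.length * k) +
          Fintype.card (G.Coloring n) * (s.length + 1) := by
        rw [add_mul]; exact add_le_add h1 h2
      _ ≤ Fintype.card (G.Coloring n) * ((e :: s).length * k) := by
        rw [← mul_add, List.length_cons, add_mul, one_mul]
        gcongr

open Classical in
/-- A reduced nontrivial walk closes up in a random lift with small probability. -/
theorem card_fixed_mul_le {n : ℕ} (i : Fin n) {s : List E} (hred : G.IsReduced s) (hne : s ≠ [])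
    {k : ℕ} (hk : s.length ≤ k) :
    (Finset.univ.filter fun σ : G.Coloring n => G.revAct σ i s = i).card * (n - k) ≤
      Fintype.card (G.Coloring n) * (k * k) := by
  refine le_trans (Nat.mul_le_mul_right _ (Finset.card_le_card ?_))
    ((G.card_not_nodup_revOrbit_mul_le i hred hk).trans
      (Nat.mul_le_mul_left _ (Nat.mul_le_mul_right _ hk)))
  intro σ
  simp only [Finset.mem_filter, Finset.mem_univ, true_and]
  intro h hnd
  -- The empty suffix sits at `i`, so a nonempty walk ending at `i` repeats a position.
  exact hne (G.eq_of_revAct_eq hnd (List.nil_suffix) h.symm).symm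

end SerreGraph

/-! ## Moments of spectral measures -/

theorem Matrix.IsHermitian.sum_eigenvalues_pow {n : Type*} [Fintype n] [DecidableEq n]
    {A : Matrix n n ℝ} (hA : A.IsHermitian) (k : ℕ) :
    ∑ i, hA.eigenvalues i ^ k = (A ^ k).trace := by
  conv_rhs => rw [hA.spectral_theorem]
  rw [← map_pow, Unitary.conjStarAlgAut_apply, Matrix.trace_mul_comm, ← mul_assoc,
    Unitary.coe_star_mul_self, one_mul, Matrix.diagonal_pow, Matrix.trace_diagonal]
  rfl

namespace SerreGraph

variable {V E : Type*} (G : SerreGraph V E)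

theorem abs_eigenvalues_le [Fintype V] [DecidableEq V] [Fintype E] {d : ℕ}
    (hG : G.IsRegular d) (i : V) : |G.adjMatrix_isHermitian.eigenvalues i| ≤ d := by
  have hev : Module.End.HasEigenvalue (Matrix.toLin' G.adjMatrix)
      (G.adjMatrix_isHermitian.eigenvalues i) := by
    rw [Module.End.hasEigenvalue_iff_mem_spectrum, Matrix.spectrum_toLin']
    exact G.adjMatrix_isHermitian.eigenvalues_mem_spectrum_real i
  -- Gershgorin: some disc has centre `A v v` and radius the rest of row `v`; the entries are
  -- nonnegative with sum `d`.
  obtain ⟨v, hv⟩ := eigenvalue_mem_ball hev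
  have hnn : ∀ u, ‖G.adjMatrix v u‖ = G.adjMatrix v u := fun u =>
    Real.norm_of_nonneg (Nat.cast_nonneg _)
  have hrow : ∑ u, G.adjMatrix v u = d := by
    have := G.adjMatrix_mulVec (fun _ => 1) v
    simpa [Matrix.mulVec, dotProduct, G.card_edgesFrom hG] using this
  rw [Metric.mem_closedBall, Real.dist_eq] at hv
  simp only [hnn] at hv
  rw [← hrow, ← Finset.add_sum_erase _ _ (Finset.mem_univ v)]
  have h0 := hnn v ▸ norm_nonneg (G.adjMatrix v v)
  rw [abs_le] at hv ⊢
  constructor <;> linarith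

theorem integral_normalizedSpectralMeasure [Fintype V] [DecidableEq V] [Nonempty V] (q : ℕ)
    (f : ℝ → ℝ) :
    ∫ x, f x ∂(G.normalizedSpectralMeasure q : Measure ℝ) = (Fintype.card V : ℝ)⁻¹ *
      ∑ i, f ((√(q : ℝ))⁻¹ * G.adjMatrix_isHermitian.eigenvalues i) := by
  change ∫ x, f x ∂((Fintype.card V : ENNReal)⁻¹ • ∑ i : V, Measure.dirac
    ((√(q : ℝ))⁻¹ * G.adjMatrix_isHermitian.eigenvalues i)) = _
  rw [integral_smul_measure, integral_finsetSum_measure]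
  · simp
  · intro i _
    exact integrable_dirac (by simp)

theorem integral_pow_normalizedSpectralMeasure [Fintype V] [DecidableEq V] [Nonempty V]
    (q k : ℕ) :
    ∫ x, x ^ k ∂(G.normalizedSpectralMeasure q : Measure ℝ) =
      (Fintype.card V : ℝ)⁻¹ * ((√(q : ℝ))⁻¹ ^ k * (G.adjMatrix ^ k).trace) := by
  rw [integral_normalizedSpectralMeasure]
  simp only [mul_pow]
  rw [← Finset.mul_sum, Matrix.IsHermitian.sum_eigenvalues_pow]

theorem ae_abs_le_normalizedSpectralMeasure [Fintype V] [DecidableEq V] [Nonempty V] [Fintype E]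
    {d : ℕ} (hG : G.IsRegular d) (q : ℕ) :
    ∀ᵐ x ∂(G.normalizedSpectralMeasure q : Measure ℝ), |x| ≤ (√(q : ℝ))⁻¹ * d := by
  change ∀ᵐ x ∂((Fintype.card V : ENNReal)⁻¹ • ∑ i : V, Measure.dirac
    ((√(q : ℝ))⁻¹ * G.adjMatrix_isHermitian.eigenvalues i)), _
  refine Measure.ae_smul_measure ?_ _
  rw [ae_iff, Measure.finsetSum_apply, Finset.sum_eq_zero]
  intro i _
  rw [← ae_iff, ae_dirac_eq]
  change |(√(q : ℝ))⁻¹ * G.adjMatrix_isHermitian.eigenvalues i| ≤ _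
  rw [abs_mul, abs_of_nonneg (by positivity)]
  exact mul_le_mul_of_nonneg_left (G.abs_eigenvalues_le hG i) (by positivity)

end SerreGraph

theorem integral_pow_kestenMcKay (q k : ℕ) :
    ∫ x, x ^ k ∂(kestenMcKay q : Measure ℝ) = (√(q : ℝ))⁻¹ ^ k * returnCount q k 0 := by
  have h := (kestenMcKay_spec q).2 (Polynomial.X ^ k)
  simp only [Polynomial.eval_pow, Polynomial.eval_X, map_pow, Polynomial.aeval_X] at h
  rw [h, smul_pow, LinearMap.smul_apply, Pi.smul_apply, regularTree_adjOperator_pow_single,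
    smul_eq_mul]
  rfl

theorem exists_ae_abs_le_kestenMcKay (q : ℕ) :
    ∃ R : ℝ, ∀ᵐ x ∂(kestenMcKay q : Measure ℝ), |x| ≤ R := by
  obtain ⟨R, hR⟩ := (kestenMcKay_spec q).1
  refine ⟨R, ?_⟩
  have := (prob_compl_eq_zero_iff (μ := (kestenMcKay q : Measure ℝ)) measurableSet_Icc).2 hR
  rw [ae_iff]
  convert this using 2
  ext x
  simp [abs_le]

/-! ## Convergence of moments and weak convergence -/

theorem integrable_of_ae_abs_le (μ : ProbabilityMeasure ℝ) {R : ℝ}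
    (hμ : ∀ᵐ x ∂(μ : Measure ℝ), |x| ≤ R) {f : ℝ → ℝ} (hf : Continuous f) :
    Integrable f (μ : Measure ℝ) := by
  obtain ⟨C, hC⟩ := (isCompact_Icc (a := -R) (b := R)).exists_bound_of_continuousOn hf.continuousOn
  exact Integrable.of_bound hf.aestronglyMeasurable C
    (hμ.mono fun x hx => hC x (abs_le.1 hx))

/-- Weierstrass approximation on the common support `[-R, R]`. -/
theorem tendsto_integral_of_tendsto_moments {ν : ℕ → ProbabilityMeasure ℝ}
    {μ : ProbabilityMeasure ℝ} {R : ℝ} (hν : ∀ j, ∀ᵐ x ∂(ν j : Measure ℝ), |x| ≤ R)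
    (hμ : ∀ᵐ x ∂(μ : Measure ℝ), |x| ≤ R)
    (h : ∀ k : ℕ, Tendsto (fun j => ∫ x, x ^ k ∂(ν j : Measure ℝ)) atTop
      (𝓝 (∫ x, x ^ k ∂(μ : Measure ℝ)))) {f : ℝ → ℝ} (hf : Continuous f) :
    Tendsto (fun j => ∫ x, f x ∂(ν j : Measure ℝ)) atTop (𝓝 (∫ x, f x ∂(μ : Measure ℝ))) := by
  have hpoly : ∀ p : Polynomial ℝ, Tendsto (fun j => ∫ x, p.eval x ∂(ν j : Measure ℝ)) atTop
      (𝓝 (∫ x, p.eval x ∂(μ : Measure ℝ))) := by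
    intro p
    have hexp : ∀ ρ : ProbabilityMeasure ℝ, (∀ᵐ x ∂(ρ : Measure ℝ), |x| ≤ R) →
        ∫ x, p.eval x ∂(ρ : Measure ℝ) =
          ∑ i ∈ Finset.range (p.natDegree + 1), p.coeff i * ∫ x, x ^ i ∂(ρ : Measure ℝ) := by
      intro ρ hρ
      simp only [Polynomial.eval_eq_sum_range]
      rw [integral_finsetSum]
      · simp only [integral_const_mul]
      · exact fun i _ => integrable_of_ae_abs_le ρ hρ (by fun_prop)
    simp only [hexp μ hμ, fun j => hexp (ν j) (hν j)]
    exact tendsto_finsetSum _ fun i _ => (h i).const_mul _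
  rw [Metric.tendsto_atTop]
  intro ε hε
  obtain ⟨p, hp⟩ := exists_polynomial_near_of_continuousOn (-R) R f hf.continuousOn (ε / 3)
    (by positivity)
  obtain ⟨N, hN⟩ := Metric.tendsto_atTop.1 (hpoly p) (ε / 3) (by positivity)
  have hclose : ∀ ρ : ProbabilityMeasure ℝ, (∀ᵐ x ∂(ρ : Measure ℝ), |x| ≤ R) →
      |∫ x, p.eval x ∂(ρ : Measure ℝ) - ∫ x, f x ∂(ρ : Measure ℝ)| ≤ ε / 3 := by
    intro ρ hρ
    rw [← integral_sub (integrable_of_ae_abs_le ρ hρ p.continuous)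
      (integrable_of_ae_abs_le ρ hρ hf)]
    have := norm_integral_le_of_norm_le_const (μ := (ρ : Measure ℝ))
      (f := fun x => p.eval x - f x) (C := ε / 3)
      (hρ.mono fun x hx => (hp x (abs_le.1 hx)).le)
    simpa using this
  refine ⟨N, fun j hj => ?_⟩
  have h1 := abs_le.1 (hclose (ν j) (hν j))
  have h2 := abs_le.1 (hclose μ hμ)
  have h3 := hN j hj
  rw [Real.dist_eq, abs_lt] at h3 ⊢
  constructor <;> linarith [h1.1, h1.2, h2.1, h2.2, h3.1, h3.2]

/-- Among the measures with a given bounded support, the closeness of finitely many moments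
implies closeness in a metric of weak convergence. -/
theorem IsWeakMetric.exists_moments {d : ProbabilityMeasure ℝ → ProbabilityMeasure ℝ → ℝ}
    (hd : IsWeakMetric d) {μ : ProbabilityMeasure ℝ} {R : ℝ}
    (hμ : ∀ᵐ x ∂(μ : Measure ℝ), |x| ≤ R) {ε : ℝ} (hε : 0 < ε) :
    ∃ K : ℕ, ∃ δ : ℝ, 0 < δ ∧ ∀ ν : ProbabilityMeasure ℝ, (∀ᵐ x ∂(ν : Measure ℝ), |x| ≤ R) →
      (∀ k < K, |∫ x, x ^ k ∂(ν : Measure ℝ) - ∫ x, x ^ k ∂(μ : Measure ℝ)| < δ) →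
        d ν μ ≤ ε := by
  by_contra! hcon
  -- Taking `K = j` and `δ = 1 / (j + 1)` gives a sequence all of whose moments converge although it
  -- stays `ε`-far from `μ`.
  choose ν hν hmom hfar using fun j : ℕ => hcon j (1 / ((j : ℝ) + 1)) (by positivity)
  have hconv : ∀ k : ℕ, Tendsto (fun j => ∫ x, x ^ k ∂(ν j : Measure ℝ)) atTop
      (𝓝 (∫ x, x ^ k ∂(μ : Measure ℝ))) := by
    intro k
    rw [tendsto_iff_dist_tendsto_zero]
    refine squeeze_zero' (Eventually.of_forall fun _ => dist_nonneg) ?_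
      tendsto_one_div_add_atTop_nhds_zero_nat
    filter_upwards [eventually_gt_atTop k] with j hj
    exact (hmom j k hj).le
  have := (hd.tendsto_iff ν μ).2 fun f =>
    tendsto_integral_of_tendsto_moments hν hμ hconv f.continuous
  exact absurd (ge_of_tendsto' this fun j => (hfar j).le) (not_le.2 hε)

namespace SerreGraph

variable {V E : Type*} (G : SerreGraph V E)

/-! ## Moments of the spectral measure of a random lift -/

/-- The moments of the spectral measure of a random lift are close to those of the Kesten–McKay
distribution in mean. -/
theorem sum_abs_moment_sub_le [Fintype V] [DecidableEq V] [Nonempty V] [Fintype E] {q : ℕ}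
    (hG : G.IsRegular (q + 1)) {n : ℕ+} {k : ℕ} (hk : k < n) :
    (∑ σ : G.Coloring n, |∫ x, x ^ k ∂((G.lift σ).normalizedSpectralMeasure q : Measure ℝ) -
        ∫ x, x ^ k ∂(kestenMcKay q : Measure ℝ)|) * ((n : ℕ) - k : ℝ) ≤
      Fintype.card (G.Coloring n) * ((√(q : ℝ))⁻¹ ^ k * ((q + 1 : ℕ) : ℝ) ^ k * (k * k)) := by
  classical
  set c : ℝ := (√(q : ℝ))⁻¹ ^ k with hc
  have hc0 : 0 ≤ c := by positivity
  set M : ℝ := (Fintype.card (V × Fin n) : ℝ) with hM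
  have hM0 : 0 < M := by rw [hM]; exact_mod_cast Fintype.card_pos
  let bad (σ : G.Coloring n) (i : Fin n) (l : List E) : ℝ :=
    if l.foldl G.push [] ≠ [] ∧ G.revAct σ i (l.foldl G.push []) = i then 1 else 0
  have hnk : (0 : ℝ) ≤ (n : ℕ) - k := sub_nonneg.2 (by exact_mod_cast hk.le)
  have hσ : ∀ σ : G.Coloring n,
      |∫ x, x ^ k ∂((G.lift σ).normalizedSpectralMeasure q : Measure ℝ) -
        ∫ x, x ^ k ∂(kestenMcKay q : Measure ℝ)| ≤
          M⁻¹ * (c * ∑ p : V × Fin n, ∑ l ∈ G.walks k p.1, bad σ p.2 l) := by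
    intro σ
    have heq : ∫ x, x ^ k ∂((G.lift σ).normalizedSpectralMeasure q : Measure ℝ) -
        ∫ x, x ^ k ∂(kestenMcKay q : Measure ℝ) =
          M⁻¹ * (c * ∑ p, (((G.lift σ).adjMatrix ^ k) p p - returnCount q k 0)) := by
      rw [integral_pow_normalizedSpectralMeasure, integral_pow_kestenMcKay, Finset.sum_sub_distrib,
        Finset.sum_const, Finset.card_univ, nsmul_eq_mul, ← hM, ← hc, Matrix.trace]
      simp only [Matrix.diag_apply]
      field_simp
    rw [heq, abs_of_nonneg]
    · gcongr with p
      have := G.adjMatrix_lift_pow_le hG σ k p.1 p.2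
      exact sub_le_iff_le_add'.2 this
    · have : 0 ≤ ∑ p, (((G.lift σ).adjMatrix ^ k) p p - returnCount q k 0) :=
        Finset.sum_nonneg fun p _ =>
          sub_nonneg.2 (G.returnCount_le_adjMatrix_lift_pow hG σ k p.1 p.2)
      positivity
  have hbad : ∀ (v : V) (i : Fin n), ∀ l ∈ G.walks k v,
      (∑ σ, bad σ i l) * ((n : ℕ) - k : ℝ) ≤ Fintype.card (G.Coloring n) * (k * k) := by
    intro v i l hl
    by_cases hne : l.foldl G.push [] = []
    · simp only [bad, hne, ne_eq, not_true_eq_false, false_and, if_false, Finset.sum_const_zero,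
        zero_mul]
      positivity
    · have hred : G.IsReduced (l.foldl G.push []) := IsReduced.foldl_push G List.isChain_nil l
      have hlen := G.length_foldl_push_le [] l
      rw [(G.mem_walks.1 hl).1, List.length_nil, zero_add] at hlen
      have := G.card_fixed_mul_le i hred hne hlen
      simp only [bad, ne_eq, hne, not_false_eq_true, true_and, Finset.sum_boole]
      -- Since `k < n`, the truncated subtraction of the counting bound agrees with the real one.
      rw [← Nat.cast_sub hk.le]
      exact_mod_cast this
  calc _ ≤ (∑ σ : G.Coloring n, M⁻¹ * (c * ∑ p : V × Fin n, ∑ l ∈ G.walks k p.1, bad σ p.2 l)) *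
        ((n : ℕ) - k : ℝ) := by gcongr with σ; exact hσ σ
    _ = M⁻¹ * (c * ∑ p : V × Fin n, ∑ l ∈ G.walks k p.1,
        (∑ σ, bad σ p.2 l) * ((n : ℕ) - k : ℝ)) := by
      simp only [← Finset.mul_sum, ← Finset.sum_mul]
      rw [Finset.sum_comm, mul_assoc, mul_assoc]
      have hcomm : ∀ p : V × Fin n, ∑ σ, ∑ l ∈ G.walks k p.1, bad σ p.2 l =
          ∑ l ∈ G.walks k p.1, ∑ σ, bad σ p.2 l := fun p => Finset.sum_comm
      simp only [hcomm]
    _ ≤ M⁻¹ * (c * ∑ p : V × Fin n, ∑ l ∈ G.walks k p.1,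
        (Fintype.card (G.Coloring n) * (k * k) : ℝ)) := by
      refine mul_le_mul_of_nonneg_left (mul_le_mul_of_nonneg_left ?_ hc0) (inv_nonneg.2 hM0.le)
      exact Finset.sum_le_sum fun p _ => Finset.sum_le_sum fun l hl => hbad p.1 p.2 l hl
    _ = _ := by
      -- There are `M` starting points with `(q + 1)^k` walks each, and `M` cancels against the
      -- normalization.
      simp only [Finset.sum_const, nsmul_eq_mul, G.card_walks hG, Finset.card_univ]
      rw [← hM]
      field_simp

/-- Markov's inequality, applied to the mean error of order `1 / (n - k)`. -/
theorem tendsto_uniformOn_moment [Fintype V] [DecidableEq V] [Nonempty V] [Fintype E] {q : ℕ}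
    (hG : G.IsRegular (q + 1)) (k : ℕ) {δ : ℝ} (hδ : 0 < δ) :
    Tendsto (fun n : ℕ+ => ProbabilityTheory.uniformOn (Set.univ : Set (G.Coloring n))
      {σ | δ ≤ |∫ x, x ^ k ∂((G.lift σ).normalizedSpectralMeasure q : Measure ℝ) -
        ∫ x, x ^ k ∂(kestenMcKay q : Measure ℝ)|}) atTop (𝓝 0) := by
  classical
  set C : ℝ := (√(q : ℝ))⁻¹ ^ k * ((q + 1 : ℕ) : ℝ) ^ k * (k * k) with hC
  have hcoe : Tendsto (fun n : ℕ+ => (n : ℕ)) atTop atTop := tendsto_PNat_val_atTop_atTop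
  have hlim : Tendsto (fun n : ℕ+ => ENNReal.ofReal (C / δ / (((n : ℕ) : ℝ) - k))) atTop
      (𝓝 0) := by
    rw [← ENNReal.ofReal_zero]
    refine ENNReal.tendsto_ofReal (Tendsto.div_atTop tendsto_const_nhds ?_)
    exact tendsto_atTop_add_const_right _ _ (tendsto_natCast_atTop_atTop.comp hcoe)
  refine tendsto_of_tendsto_of_tendsto_of_le_of_le' tendsto_const_nhds hlim
    (Eventually.of_forall fun _ => zero_le) ?_
  filter_upwards [hcoe.eventually (eventually_gt_atTop k)] with n hn
  let X (σ : G.Coloring n) : ℝ :=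
    |∫ x, x ^ k ∂((G.lift σ).normalizedSpectralMeasure q : Measure ℝ) -
        ∫ x, x ^ k ∂(kestenMcKay q : Measure ℝ)|
  have hmean : (∑ σ, X σ) * ((n : ℕ) - k : ℝ) ≤ Fintype.card (G.Coloring n) * C :=
    G.sum_abs_moment_sub_le hG hn
  set S := Finset.univ.filter fun σ => δ ≤ X σ with hS
  have hmarkov : S.card * δ ≤ ∑ σ, X σ := by
    rw [← nsmul_eq_mul]
    exact (Finset.card_nsmul_le_sum S X δ fun σ hσ => (Finset.mem_filter.1 hσ).2).trans
      (Finset.sum_le_univ_sum_of_nonneg fun σ => abs_nonneg _)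
  have hset : {σ | δ ≤ X σ} = (S : Set (G.Coloring n)) := by ext; simp [hS]
  have hmeas : MeasurableSet (S : Set (G.Coloring n)) := MeasurableSpace.measurableSet_top
  have hcard : (0 : ℝ) < Fintype.card (G.Coloring n) := by exact_mod_cast Fintype.card_pos
  have hnk : (0 : ℝ) < (n : ℕ) - k := sub_pos.2 (by exact_mod_cast hn)
  change ProbabilityTheory.uniformOn Set.univ {σ | δ ≤ X σ} ≤ _
  rw [hset, ProbabilityTheory.uniformOn_univ, Measure.count_apply_finset' hmeas,
    ← ENNReal.ofReal_natCast, ← ENNReal.ofReal_natCast, ← ENNReal.ofReal_div_of_pos hcard]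
  refine ENNReal.ofReal_le_ofReal ?_
  rw [div_div, div_le_div_iff₀ hcard (by positivity)]
  nlinarith [mul_le_mul_of_nonneg_right hmarkov hnk.le]

end SerreGraph

end

theorem theorem3p2 {V E : Type*} [Fintype V] [DecidableEq V] [Nonempty V] [Fintype E]
    (q : ℕ) (hq : 1 ≤ q) (G : SerreGraph V E) (hG : G.IsRegular (q + 1)) :
    ConvergesWeaklyInProbability atTop
      (fun n : ℕ+ => ProbabilityTheory.uniformOn (Set.univ : Set (G.Coloring n)))
      (fun n σ => (G.lift σ).normalizedSpectralMeasure q)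
      (kestenMcKay q) := by
  intro d hd ε hε
  obtain ⟨R, hR⟩ := exists_ae_abs_le_kestenMcKay q
  obtain ⟨K, δ, hδ, hclose⟩ := hd.exists_moments (μ := kestenMcKay q)
    -- One interval must contain the supports of the limit and of all the lifts.
    (R := max R ((√(q : ℝ))⁻¹ * (q + 1 : ℕ)))
    (hR.mono fun x hx => hx.trans (le_max_left _ _)) hε
  have hsum := tendsto_finsetSum (Finset.range K) fun k _ =>
    G.tendsto_uniformOn_moment hG k hδ
  rw [Finset.sum_const_zero] at hsum
  refine tendsto_of_tendsto_of_tendsto_of_le_of_le tendsto_const_nhds hsum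
    (fun _ => zero_le) fun n => ?_
  refine le_trans (measure_mono ?_) (measure_biUnion_finset_le _ _)
  intro σ hσ
  -- If no moment below `K` deviates by `δ`, the measures are `ε`-close; so the bad event lies in
  -- the union.
  by_contra hnot
  simp only [Set.mem_iUnion, Finset.mem_range, Set.mem_ofPred_eq, not_exists, not_le] at hnot
  refine absurd (hclose _ ?_ hnot) (not_le.2 hσ)
  exact ((G.lift σ).ae_abs_le_normalizedSpectralMeasure (G.isRegular_lift hG σ) q).mono
    fun x hx => hx.trans (le_max_right _ _)
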